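/- Let $X$ be a metric space with metric $d$ and base point $e$. Let $F(X,e)$ be the free group on $X$ in which $e$ is the unit (so $X\setminus\{e\}$ is a free basis), with the free topological group topology, i.e. the finest group topology for which the canonical map $X\to F(X,e)$ is continuous. Extend $d$ to $X\cup X^{-1}$ by $\bar d(x,y)=\bar d(x^{-1},y^{-1})=d(x,y)$ and $\bar d(x,y^{-1})=\bar d(x^{-1},y)=d(x,e)+d(e,y)$ for $x,y\in X$. The Graev norm of $g\in F(X,e)$ with reduced word $x_1\cdots x_k$ ($x_i\in X\cup X^{-1}$) is $$N(g)=\frac12\min_{\alpha\in\sigma_k}\sum_{i=1}^k \bar d\bigl(x_i,x_{\alpha(i)}^{-1}\bigr),$$ where $\sigma_k$ is the set of all permutations $\alpha$ of $\{1,\dots,k\}$ such that $\alpha^2=1$ and such that for all $i<j$ one of the following holds: $\alpha(j)<i$ and $\alpha(j)<\alpha(i)<j$; $\alpha(i)>j$ and $i<\alpha(j)<\alpha(i)$; $i<\alpha(j)$, $\alpha(i)<\alpha(j)$ and $\alpha(i)<j$; $\alpha(j)=i$. Now let $X=[0,1]$ with $d(x,y)=|x-y|$ and $e=0$. Let $n$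 be a natural number, and for $c>0$ let $H_c$ be the subgroup of $F(X,e)$ generated by all $x^n$ with $x\in F(X,e)$, $N(x)<c$. If $0<c_1<c_2<+\infty$, then the closure of $H_{c_1}$ in the free topological group $F(X,e)$ is contained in $H_{c_2}$. -/

import Mathlib

section GraevFreeGroup

/-- The free group `F(X, e)` over a set `X` with base point `e`, in which `e` is the unit: its free
generators are the points of `X` other than `e`. -/
def PointedFreeGroup (X : Type*) (e : X) : Type _ := FreeGroup {x : X // x ≠ e}

namespace PointedFreeGroup

instance {X : Type*} (e : X) : Group (PointedFreeGroup X e) :=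
  inferInstanceAs (Group (FreeGroup {x : X // x ≠ e}))

open Classical in
/-- The canonical map `X → F(X, e)`; it sends `e` to the unit. -/
noncomputable def of {X : Type*} (e : X) (x : X) : PointedFreeGroup X e :=
  if h : x = e then 1 else FreeGroup.of (⟨x, h⟩ : {x : X // x ≠ e})

/-- The topology of the free topological group on the pointed space `(X, e)`: the finest group
topology on `F(X, e)` for which the canonical map `X → F(X, e)` is continuous. -/
noncomputable instance {X : Type*} [TopologicalSpace X] (e : X) :
    TopologicalSpace (PointedFreeGroup X e) :=
  (GroupTopology.coinduced (of e)).toTopologicalSpace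

/-- The signed letters of `X ∪ X⁻¹`: `(x, true)` stands for `x` and `(x, false)` for `x⁻¹`. -/
abbrev Letter (X : Type*) : Type _ := X × Bool

/-- The formal inverse of a letter. -/
def Letter.inv {X : Type*} (a : Letter X) : Letter X := (a.1, !a.2)

/-- The extension of the metric `d` of `X` to `X ∪ X⁻¹`: `d(x, y) = d(x⁻¹, y⁻¹)` is the given
distance, and `d(x, y⁻¹) = d(x⁻¹, y) = d(x, e) + d(e, y)`. -/
noncomputable def Letter.dist {X : Type*} [MetricSpace X] (e : X) (a b : Letter X) : ℝ :=
  if a.2 = b.2 then Dist.dist a.1 b.1 else Dist.dist a.1 e + Dist.dist e b.1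

/-- The set `σ_k` of permutations `α` of `k` points with `α² = 1` and such that, for any `i < j`,
one of four alternatives holds: `i` and `α i` lie strictly inside the arc from `α j` to `j`; or
`j` and `α j` lie strictly inside the arc from `i` to `α i`; or the orbit of `i` lies to the left
of the orbit of `j` as described; or `α j = i`. -/
def IsNoncrossingInvolution {k : ℕ} (α : Equiv.Perm (Fin k)) : Prop :=
  (∀ i, α (α i) = i) ∧
  ∀ i j, i < j →
    (α j < i ∧ α j < α i ∧ α i < j) ∨
    (j < α i ∧ i < α j ∧ α j < α i) ∨
    (i < α j ∧ α i < α j ∧ α i < j) ∨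
    α j = i

theorem isNoncrossingInvolution_one (k : ℕ) :
    IsNoncrossingInvolution (1 : Equiv.Perm (Fin k)) :=
  ⟨fun _ => rfl, fun _ _ h => Or.inr (Or.inr (Or.inl ⟨h, h, h⟩))⟩

instance (k : ℕ) : Nonempty {α : Equiv.Perm (Fin k) // IsNoncrossingInvolution α} :=
  ⟨⟨1, isNoncrossingInvolution_one k⟩⟩

/-- For a word `x₁ … x_k` in the letters of `X ∪ X⁻¹`, the minimum over `α ∈ σ_k` of
`(1/2) ∑ d(x_i, x_{α(i)}⁻¹)`. The infimum is over a finite nonempty family, so it is a minimum. -/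
noncomputable def wordNorm {X : Type*} [MetricSpace X] (e : X) (w : List (Letter X)) : ℝ :=
  (1 / 2 : ℝ) *
    ⨅ α : {α : Equiv.Perm (Fin w.length) // IsNoncrossingInvolution α},
      ∑ i : Fin w.length, Letter.dist e (w.get i) (Letter.inv (w.get (α.1 i)))

open Classical in
/-- The reduced word of an element of `F(X, e)`. -/
noncomputable def reducedWord {X : Type*} {e : X} (g : PointedFreeGroup X e) : List (Letter X) :=
  (FreeGroup.toWord (α := {x : X // x ≠ e}) g).map fun a => ((a.1 : X), a.2)

/-- The Graev norm `N` on `F(X, e)`, computed from the reduced word. -/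
noncomputable def graevNorm {X : Type*} [MetricSpace X] {e : X} (g : PointedFreeGroup X e) : ℝ :=
  wordNorm e (reducedWord g)

/-- The subgroup `H_c` of `F(X, e)` generated by the `n`-th powers of the elements of Graev norm
less than `c`. -/
noncomputable def powerSubgroup {X : Type*} [MetricSpace X] (e : X) (n : ℕ) (c : ℝ) :
    Subgroup (PointedFreeGroup X e) :=
  Subgroup.closure {y | ∃ x : PointedFreeGroup X e, graevNorm x < c ∧ y = x ^ n}

end PointedFreeGroup

end GraevFreeGroup

/-!
Let `g` lie in the closure of `H_{c₁}`. The idea is to find a self-map `f` of `[0, 1]`, fixing `0`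
and all letters of `g`, Lipschitz with constant `c₂ / c₁`, such that the induced endomorphism `φ` of
`F([0, 1], 0)` sends some element of `H_{c₁}` to `g`. A map with Lipschitz constant `K` multiplies
Graev norms by at most `K` (`graevNorm_mapHom_le`), so that `φ` sends `H_{c₁}` into `H_{c₂}`
(`mapHom_mem_powerSubgroup`), and hence `g ∈ H_{c₂}`.

To find `f`, call an element `u` of the free group `δ`-collapsible if there is a set `E ⊆ ℝ` of
measure less than `δ` such that `u` becomes trivial when points with almost all of the interval
between them in `E` are identified. These elements form a basis of neighbourhoods of `1` for a group
topology in which `x ↦ x` is continuous on `[0, 1]`, so this topology is coarser than that of the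
free topological group (`topology_le_collapsibleBasis`). Hence, for each `δ > 0`, some product `g u`
with `u` a `δ`-collapsible element lies in `H_{c₁}` (`exists_mul_mem_of_mem_closure`). If `δ` is
small compared with the gaps between the letters of `g`, then cutting `E` out of the line shrinks the
distances between these letters by a factor close to `1`; by extension of Lipschitz functions there
is an `f` with the required constant that fixes the letters of `g` and collapses `E`
(`exists_collapse`). Then `φ(g u) = g`.

The estimate of Graev norms is not immediate, because the norm is computed from reduced words and
`f` may send a reduced word to a word that is not reduced. It needs the part of Graev's theorem that
says that the reduced word has the least norm among all words for an element
(`graevNorm_eval_le`). Given a noncrossing involution on the positions of a word, a letter `e` or two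
adjacent inverse letters are deleted and the positions that lose their partners are left fixed or
joined to each other; the result is noncrossing and no more expensive.
-/

namespace PointedFreeGroup

/-! ### Values of words, reduced words -/

section Words

variable {X : Type*} (e : X)

/-- The value in `F(X, e)` of a word in the letters of `X ∪ X⁻¹`; the word may be unreduced and may
contain the letters `e` and `e⁻¹`, whose value is `1`. -/
noncomputable def eval (w : List (Letter X)) : PointedFreeGroup X e :=
  (w.map fun a => if a.2 then of e a.1 else (of e a.1)⁻¹).prod

variable {e}

theorem eval_append (u v : List (Letter X)) : eval e (u ++ v) = eval e u * eval e v := by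
  simp [eval]

theorem eval_cons (a : Letter X) (v : List (Letter X)) :
    eval e (a :: v) = (if a.2 then of e a.1 else (of e a.1)⁻¹) * eval e v := by
  simp [eval]

theorem of_basePoint : of e e = 1 := by
  simp [of]

theorem of_coe (x : {x : X // x ≠ e}) : of e (x : X) = FreeGroup.of x := by
  exact dif_neg x.2

theorem eval_map_coe (L : List ({x : X // x ≠ e} × Bool)) :
    eval e (L.map fun a => ((a.1 : X), a.2)) = (FreeGroup.mk L : FreeGroup {x : X // x ≠ e}) := by
  induction L with
  | nil => exact FreeGroup.one_eq_mk
  | cons a L ih =>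
    rw [List.map_cons, eval_cons, ih]
    obtain ⟨x, b⟩ := a
    have h : (FreeGroup.mk ((x, b) :: L) : FreeGroup {x : X // x ≠ e})
        = FreeGroup.mk [(x, b)] * FreeGroup.mk L := by
      rw [FreeGroup.mul_mk]; rfl
    rw [h]
    cases b
    · simp only [of_coe]; rfl
    · simp only [of_coe]; rfl

theorem eval_reducedWord (g : PointedFreeGroup X e) : eval e (reducedWord g) = g := by
  classical
  rw [reducedWord, eval_map_coe]
  exact FreeGroup.mk_toWord

theorem reducedWord_eval (w : List (Letter X)) (hw : ∀ a ∈ w, a.1 ≠ e)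
    (hc : w.IsChain fun a b => a.1 = b.1 → a.2 = b.2) : reducedWord (eval e w) = w := by
  classical
  obtain ⟨L, rfl⟩ : ∃ L : List ({x : X // x ≠ e} × Bool),
      L.map (fun a => ((a.1 : X), a.2)) = w :=
    ⟨w.pmap (fun a h => (⟨a.1, h⟩, a.2)) hw, by simp [List.map_pmap]⟩
  have hL : FreeGroup.IsReduced L := by
    rw [List.isChain_map] at hc
    exact hc.imp fun a b h hab => h (congrArg Subtype.val hab)
  rw [eval_map_coe]
  unfold reducedWord
  congr 1
  exact FreeGroup.toWord_mk.trans (FreeGroup.isReduced_iff_reduce_eq.1 hL)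

theorem Letter.inv_inv (a : Letter X) : a.inv.inv = a := by
  simp [Letter.inv]

end Words

/-! ### The metric on letters -/

section LetterMetric

variable {X : Type*} [MetricSpace X] (e : X)

theorem Letter.dist_nonneg (a b : Letter X) : 0 ≤ Letter.dist e a b := by
  rw [Letter.dist]; split_ifs <;> positivity

theorem Letter.dist_triangle (a b c : Letter X) :
    Letter.dist e a c ≤ Letter.dist e a b + Letter.dist e b c := by
  obtain ⟨a, i⟩ := a
  obtain ⟨b, j⟩ := b
  obtain ⟨c, k⟩ := c
  have h₁ := _root_.dist_triangle a b c
  have h₂ := _root_.dist_triangle a e c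
  have h₃ := _root_.dist_triangle a b e
  have h₄ := _root_.dist_triangle e b c
  have h₅ := _root_.dist_comm e b
  have h₆ := _root_.dist_nonneg (x := e) (y := b)
  cases i <;> cases j <;> cases k <;> simp [Letter.dist] <;> linarith

end LetterMetric

/-! ### Noncrossing involutions and deletion of positions -/

section Noncrossing

variable {ι : Type*} [LinearOrder ι]

/-- A noncrossing involution of a finite set `s` of positions: if `j` lies strictly between `i` and
`α i`, then so does `α j`. Fixed points are allowed anywhere, also below an arc. Only the values of
`α` on `s` matter. -/
structure IsNoncrossingOn (s : Finset ι) (α : ι → ι) : Prop where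
  mem : ∀ i ∈ s, α i ∈ s
  involutive : ∀ i ∈ s, α (α i) = i
  nested : ∀ i ∈ s, ∀ j ∈ s, i < j → j < α i → i < α j ∧ α j < α i

/-- For an involution, the four alternatives in the definition of `σ_k` say just that no two arcs
cross. -/
theorem isNoncrossingInvolution_iff {k : ℕ} (α : Equiv.Perm (Fin k)) :
    IsNoncrossingInvolution α ↔ IsNoncrossingOn Finset.univ α := by
  constructor
  · rintro ⟨h₁, h₂⟩
    refine ⟨by simp, fun i _ => h₁ i, fun i _ j _ hij hj => ?_⟩
    have := h₁ i
    have := h₁ j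
    rcases h₂ i j hij with h | h | h | h
    · grind
    · grind
    · grind
    · grind
  · rintro ⟨-, h₁, h₂⟩
    refine ⟨fun i => h₁ i (Finset.mem_univ _), fun i j hij => ?_⟩
    have a₁ := h₁ i (Finset.mem_univ _)
    have a₂ := h₁ j (Finset.mem_univ _)
    have b₁ := h₂ i (Finset.mem_univ _) j (Finset.mem_univ _)
    have b₂ := h₂ (α j) (Finset.mem_univ _) i (Finset.mem_univ _)
    have b₃ := h₂ (α j) (Finset.mem_univ _) (α i) (Finset.mem_univ _)
    grind

/-- The involution left after the position `p` has been removed: the partner of `p` becomes a fixed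
point. -/
def eraseOne (α : ι → ι) (p : ι) (i : ι) : ι := if α i = p then i else α i

/-- The involution left after two adjacent positions `p` and `q` have been removed: the partners of
`p` and `q` are joined to each other; if only one of `p` and `q` has a partner elsewhere, that
partner becomes a fixed point. -/
def eraseTwo (α : ι → ι) (p q : ι) (i : ι) : ι :=
  if α i = p then (if α q = q then i else α q)
  else if α i = q then (if α p = p then i else α p) else α i

theorem IsNoncrossingOn.eraseOne {s : Finset ι} {α : ι → ι} (h : IsNoncrossingOn s α)
    (p : ι) : IsNoncrossingOn (s.erase p) (eraseOne α p) := by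
  obtain ⟨h₁, h₂, h₃⟩ := h
  unfold PointedFreeGroup.eraseOne
  refine ⟨fun i hi => ?_, fun i hi => ?_, fun i hi j hj hij hj' => ?_⟩
  · grind
  · grind
  · have := h₃ i (by grind) j (by grind) hij
    grind

theorem IsNoncrossingOn.eraseTwo {s : Finset ι} {α : ι → ι} (h : IsNoncrossingOn s α)
    {p q : ι} (hp : p ∈ s) (hq : q ∈ s) (hpq : p < q) (hadj : ∀ i ∈ s, i ≤ p ∨ q ≤ i) :
    IsNoncrossingOn ((s.erase p).erase q) (eraseTwo α p q) := by
  obtain ⟨h₁, h₂, h₃⟩ := h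
  have p₁ := h₁ p hp
  have q₁ := h₁ q hq
  have p₂ := h₂ p hp
  have q₂ := h₂ q hq
  unfold PointedFreeGroup.eraseTwo
  refine ⟨fun i hi => ?_, fun i hi => ?_, fun i hi j hj hij hj' => ?_⟩
  · grind
  · grind
  · simp only [Finset.mem_erase] at hi hj
    have i₁ := h₁ i hi.2.2
    have i₂ := h₂ i hi.2.2
    have j₁ := h₁ j hj.2.2
    have j₂ := h₂ j hj.2.2
    -- The new arcs are made of old ones ending at `p` or `q`; crossing is excluded by the relevant
    -- instances of the old condition and by the absence of positions between `p` and `q`.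
    have := hadj i hi.2.2
    have := hadj j hj.2.2
    have := hadj _ i₁
    have := hadj _ j₁
    have := h₃ i hi.2.2 j hj.2.2
    have := h₃ p hp j hj.2.2
    have := h₃ q hq j hj.2.2
    have := h₃ i hi.2.2 p hp
    have := h₃ i hi.2.2 q hq
    have := h₃ _ q₁ p hp
    have := h₃ p hp q hq
    have := h₃ q hq _ j₁
    have := h₃ _ p₁ _ j₁
    have := lt_trichotomy (α j) i
    have := lt_trichotomy (α j) (α p)
    clear h₁ h₂ h₃ hadj
    split_ifs at hj' ⊢ <;> grind (splits := 40)

end Noncrossing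

/-! ### Cancellation does not increase the cost -/

section Cost

variable {ι X : Type*} [LinearOrder ι] [MetricSpace X] (e : X)

/-- Twice the total length of the arcs of `α` on the positions `s`, when position `i` carries the
letter `w i`. -/
noncomputable def cost (w : ι → Letter X) (s : Finset ι) (α : ι → ι) : ℝ :=
  ∑ i ∈ s, Letter.dist e (w i) (w (α i)).inv

variable {e}

/-- A letter `e` can be deleted: if `p` carries `e`, an arc from `p` to `i` costs as much as leaving
`i` fixed. -/
theorem cost_eraseOne_le {w : ι → Letter X} {s : Finset ι} {α : ι → ι} (h : IsNoncrossingOn s α)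
    {p : ι} (hp : p ∈ s) (hw : (w p).1 = e) :
    cost e w (s.erase p) (eraseOne α p) ≤ cost e w s α := by
  set D := Letter.dist e with hD
  have hp0 : D (w p).inv (w p) = 0 := by
    simp [hD, Letter.dist, Letter.inv, hw]
  have key : ∀ i ∈ s.erase p, D (w i) (w (eraseOne α p i)).inv ≤
      D (w i) (w (α i)).inv + if i = α p then D (w p) (w (α p)).inv else 0 := by
    intro i hi
    have hi' := Finset.mem_erase.1 hi
    unfold eraseOne
    by_cases hip : α i = p
    · have hi2 : i = α p := by rw [← hip, h.involutive i hi'.2]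
      rw [if_pos hip, if_pos hi2, ← hi2, hip]
      have := Letter.dist_triangle e (w i) (w p).inv (w i).inv
      have := Letter.dist_triangle e (w p).inv (w p) (w i).inv
      linarith
    · rw [if_neg hip]
      have : (0 : ℝ) ≤ if i = α p then D (w p) (w (α p)).inv else 0 := by
        split_ifs
        · exact Letter.dist_nonneg _ _ _
        · rfl
      linarith
  calc cost e w (s.erase p) (eraseOne α p)
      ≤ ∑ i ∈ s.erase p, (D (w i) (w (α i)).inv + if i = α p then D (w p) (w (α p)).inv else 0) :=
        Finset.sum_le_sum key
    _ ≤ (∑ i ∈ s.erase p, D (w i) (w (α i)).inv) + D (w p) (w (α p)).inv := by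
        rw [Finset.sum_add_distrib, Finset.sum_ite_eq']
        gcongr
        split_ifs
        · rfl
        · exact Letter.dist_nonneg _ _ _
    _ = cost e w s α := Finset.sum_erase_add _ _ hp

/-- A pair of mutually inverse letters can be deleted, by the triangle inequality. -/
theorem cost_eraseTwo_le {w : ι → Letter X} {s : Finset ι} {α : ι → ι} (h : IsNoncrossingOn s α)
    {p q : ι} (hp : p ∈ s) (hq : q ∈ s) (hpq : p ≠ q) (hw : w q = (w p).inv) :
    cost e w ((s.erase p).erase q) (eraseTwo α p q) ≤ cost e w s α := by
  set D := Letter.dist e with hD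
  set c : ι → ℝ := fun i => D (w i) (w (α i)).inv with hc
  have hc0 : ∀ i, 0 ≤ c i := fun i => Letter.dist_nonneg _ _ _
  have hw' : w p = (w q).inv := by rw [hw, Letter.inv_inv]
  -- Each of the at most two positions that change their partner is charged with the arcs at `p` and
  -- `q` that its new arc replaces.
  set b : ι → ℝ := fun i => (if i = α p then c q + (if α q = q then c p else 0) else 0) +
    (if i = α q then c p + (if α p = p then c q else 0) else 0) with hb
  have hif : ∀ (P : Prop) [Decidable P] (x : ℝ), 0 ≤ x → 0 ≤ if P then x else 0 := by
    intro P _ x hx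
    split_ifs
    · exact hx
    · rfl
  have hb₁ : 0 ≤ c q + (if α q = q then c p else 0) := add_nonneg (hc0 q) (hif _ _ (hc0 p))
  have hb₂ : 0 ≤ c p + (if α p = p then c q else 0) := add_nonneg (hc0 p) (hif _ _ (hc0 q))
  have hb0 : ∀ i, 0 ≤ b i := fun i => add_nonneg (hif _ _ hb₁) (hif _ _ hb₂)
  have key : ∀ i ∈ (s.erase p).erase q, D (w i) (w (eraseTwo α p q i)).inv ≤ c i + b i := by
    intro i hi
    simp only [Finset.mem_erase] at hi
    obtain ⟨hiq, hip, his⟩ := hi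
    unfold eraseTwo
    split_ifs with h₁ h₂ h₃ h₄
    · have hi2 : i = α p := by rw [← h₁, h.involutive i his]
      have hcp : c p = D (w p) (w i).inv := by rw [hi2]
      have hcq : c q = D (w q) (w p) := by simp only [hc, h₂, hw']
      have hci : c i = D (w i) (w q) := by simp only [hc, h₁, hw]
      have hbi : b i = c q + c p := by
        have : i ≠ α q := by rw [h₂]; exact hiq
        simp only [hb]
        rw [if_pos hi2, if_pos h₂, if_neg this, add_zero]
      have := Letter.dist_triangle e (w i) (w q) (w i).inv
      have := Letter.dist_triangle e (w q) (w p) (w i).inv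
      linarith
    · have hi2 : i = α p := by rw [← h₁, h.involutive i his]
      have hcq : c q = D (w q) (w (α q)).inv := rfl
      have hci : c i = D (w i) (w q) := by simp only [hc, h₁, hw]
      have hbi : c q ≤ b i := by
        simp only [hb]
        rw [if_pos hi2, if_neg h₂, add_zero]
        linarith [hif (i = α q) _ hb₂]
      have := Letter.dist_triangle e (w i) (w q) (w (α q)).inv
      linarith
    · have hi2 : i = α q := by rw [← h₃, h.involutive i his]
      have hcp : c p = D (w p) (w q) := by simp only [hc, h₄, hw]
      have hcq : c q = D (w q) (w i).inv := by rw [hi2]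
      have hci : c i = D (w i) (w p) := by simp only [hc, h₃, hw']
      have hbi : b i = c p + c q := by
        have : i ≠ α p := by rw [h₄]; exact hip
        simp only [hb]
        rw [if_pos hi2, if_pos h₄, if_neg this, zero_add]
      have := Letter.dist_triangle e (w i) (w p) (w i).inv
      have := Letter.dist_triangle e (w p) (w q) (w i).inv
      linarith
    · have hi2 : i = α q := by rw [← h₃, h.involutive i his]
      have hcp : c p = D (w p) (w (α p)).inv := rfl
      have hci : c i = D (w i) (w p) := by simp only [hc, h₃, hw']
      have hbi : c p ≤ b i := by
        simp only [hb]
        rw [if_pos hi2, if_neg h₄, add_zero]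
        linarith [hif (i = α p) _ hb₁]
      have := Letter.dist_triangle e (w i) (w p) (w (α p)).inv
      linarith
    · linarith [hb0 i]
  have hsum : ∑ i ∈ (s.erase p).erase q, b i ≤ c q + c p := by
    simp only [hb]
    rw [Finset.sum_add_distrib, Finset.sum_ite_eq', Finset.sum_ite_eq']
    simp only [Finset.mem_erase]
    have := hc0 p
    have := hc0 q
    split_ifs <;> first | linarith | (exfalso; tauto)
  have hqs : q ∈ s.erase p := Finset.mem_erase.2 ⟨hpq.symm, hq⟩
  calc cost e w ((s.erase p).erase q) (eraseTwo α p q)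
      ≤ ∑ i ∈ (s.erase p).erase q, (c i + b i) := Finset.sum_le_sum key
    _ ≤ ∑ i ∈ (s.erase p).erase q, c i + (c q + c p) := by
        rw [Finset.sum_add_distrib]
        gcongr
    _ = cost e w s α := by
        rw [← add_assoc, Finset.sum_erase_add _ _ hqs, Finset.sum_erase_add _ _ hp]
        rfl

/-- For a word read off along the positions `s`, a noncrossing involution of `s` gives an element of
`σ_k`. -/
theorem wordNorm_map_le {w : ι → Letter X} {l : List ι} (hl : l.SortedLT) {α : ι → ι}
    (h : IsNoncrossingOn l.toFinset α) :
    wordNorm e (l.map w) ≤ 1 / 2 * cost e w l.toFinset α := by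
  have hlen : (l.map w).length = l.length := List.length_map _
  set F : Fin (l.map w).length ≃o {x // x ∈ l} := (Fin.castOrderIso hlen).trans (hl.getIso l)
    with hF
  have hwF : ∀ i, (l.map w).get i = w (F i) := by
    intro i
    simp [hF]
  have hmem : ∀ i ∈ l, α i ∈ l := by simpa using h.mem
  have hinv : ∀ i ∈ l, α (α i) = i := by simpa using h.involutive
  let β : Equiv.Perm {x // x ∈ l} :=
    ⟨fun i => ⟨α i, hmem i i.2⟩, fun i => ⟨α i, hmem i i.2⟩,
      fun i => Subtype.ext (hinv i i.2), fun i => Subtype.ext (hinv i i.2)⟩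
  let γ : Equiv.Perm (Fin (l.map w).length) := F.toEquiv.trans (β.trans F.symm.toEquiv)
  have hγ : ∀ i, ((F (γ i) : {x // x ∈ l}) : ι) = α (F i) := by
    intro i
    simp [γ, β]
  have hγN : IsNoncrossingInvolution γ := by
    rw [isNoncrossingInvolution_iff]
    refine ⟨by simp, fun i _ => ?_, fun i _ j _ hij hj => ?_⟩
    · apply F.injective
      apply Subtype.ext
      rw [hγ, hγ, hinv _ (F i).2]
    · have hij' : (F i : ι) < F j := F.lt_iff_lt.2 hij
      have hj' : (F j : ι) < α (F i) := by rw [← hγ]; exact F.lt_iff_lt.2 hj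
      have := h.nested _ (List.mem_toFinset.2 (F i).2) _ (List.mem_toFinset.2 (F j).2) hij' hj'
      rw [← hγ, ← hγ] at this
      exact ⟨F.lt_iff_lt.1 this.1, F.lt_iff_lt.1 this.2⟩
  rw [wordNorm]
  refine mul_le_mul_of_nonneg_left ?_ (by norm_num)
  refine (ciInf_le (Finite.bddBelow_range _) ⟨γ, hγN⟩).trans_eq ?_
  simp only [hwF, hγ]
  rw [cost, ← Finset.sum_coe_sort l.toFinset]
  refine Fintype.sum_equiv (F.toEquiv.trans (Equiv.subtypeEquivRight (by simp))) _ _ fun i => ?_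
  rfl

/-- Any noncrossing involution on any word for `g`, reduced or not, bounds the Graev norm of `g`
from above: cancelling letters does not increase the cost of a suitable involution. -/
theorem graevNorm_eval_le (w : ι → Letter X) (l : List ι) (hl : l.SortedLT) (α : ι → ι)
    (h : IsNoncrossingOn l.toFinset α) :
    graevNorm (eval e (l.map w)) ≤ 1 / 2 * cost e w l.toFinset α := by
  induction hn : l.length using Nat.strong_induction_on generalizing l α with
  | _ n ih =>
  -- Delete a letter `e` or two adjacent inverse letters as long as there are any.
  by_cases he : ∃ p ∈ l, (w p).1 = e
  · obtain ⟨p, hpl, hpe⟩ := he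
    obtain ⟨l₁, l₂, rfl⟩ := List.append_of_mem hpl
    have hs : (l₁ ++ p :: l₂).toFinset.erase p = (l₁ ++ l₂).toFinset := by
      have hpw := hl.pairwise
      simp only [List.pairwise_append, List.pairwise_cons] at hpw
      have h₁ : p ∉ l₁ := fun h => lt_irrefl p (hpw.2.2 p h p (by simp))
      have h₂ : p ∉ l₂ := fun h => lt_irrefl p (hpw.2.1.1 p h)
      ext x
      simp only [Finset.mem_erase, List.mem_toFinset, List.mem_append, List.mem_cons]
      clear ih
      grind
    have hp : p ∈ (l₁ ++ p :: l₂).toFinset := List.mem_toFinset.2 hpl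
    have hl' : (l₁ ++ l₂).SortedLT :=
      (hl.pairwise.sublist ((List.sublist_cons_self _ _).append_left l₁)).sortedLT
    have := ih _ (by rw [← hn]; simp) (l₁ ++ l₂) hl' (eraseOne α p) (hs ▸ h.eraseOne p) rfl
    rw [← hs] at this
    refine le_trans (le_of_eq ?_) (this.trans
      (mul_le_mul_of_nonneg_left (cost_eraseOne_le h hp hpe) (by norm_num)))
    simp [eval_append, eval_cons, hpe, of_basePoint]
  by_cases hc : (l.map w).IsChain fun a b => a.1 = b.1 → a.2 = b.2
  · rw [graevNorm, reducedWord_eval _ (by simpa using he) hc]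
    exact wordNorm_map_le hl h
  · rw [List.isChain_map, List.isChain_iff_forall_rel_of_append_cons_cons] at hc
    push Not at hc
    obtain ⟨p, q, l₁, l₂, rfl, h₁, h₂⟩ := hc
    have hw : w q = (w p).inv := by
      refine Prod.ext h₁.symm ?_
      simp only [Letter.inv]
      revert h₂
      cases (w p).2 <;> cases (w q).2 <;> simp
    have hpw := hl.pairwise
    simp only [List.pairwise_append, List.pairwise_cons] at hpw
    have hs : ((l₁ ++ p :: q :: l₂).toFinset.erase p).erase q = (l₁ ++ l₂).toFinset := by
      have h₁ : p ∉ l₁ := fun h => lt_irrefl p (hpw.2.2 p h p (by simp))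
      have h₂ : p ∉ l₂ := fun h => lt_irrefl p (hpw.2.1.1 p (by simp [h]))
      have h₃ : q ∉ l₁ := fun h => lt_irrefl q (hpw.2.2 q h q (by simp))
      have h₄ : q ∉ l₂ := fun h => lt_irrefl q (hpw.2.1.2.1 q h)
      ext x
      simp only [Finset.mem_erase, List.mem_toFinset, List.mem_append, List.mem_cons]
      clear ih
      grind
    have hp : p ∈ (l₁ ++ p :: q :: l₂).toFinset := by simp
    have hq : q ∈ (l₁ ++ p :: q :: l₂).toFinset := by simp
    have hpq : p < q := hpw.2.1.1 q (by simp)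
    have hadj : ∀ i ∈ (l₁ ++ p :: q :: l₂).toFinset, i ≤ p ∨ q ≤ i := by
      intro i hi
      simp only [List.mem_toFinset, List.mem_append, List.mem_cons] at hi
      rcases hi with hi | rfl | rfl | hi
      · exact Or.inl (hpw.2.2 i hi p (by simp)).le
      · exact Or.inl le_rfl
      · exact Or.inr le_rfl
      · exact Or.inr (hpw.2.1.2.1 i hi).le
    have hl' : (l₁ ++ l₂).SortedLT :=
      (hl.pairwise.sublist (((List.sublist_cons_self _ _).trans
        (List.sublist_cons_self _ _)).append_left l₁)).sortedLT
    have := ih _ (by rw [← hn]; simp) (l₁ ++ l₂) hl' (eraseTwo α p q)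
      (hs ▸ h.eraseTwo hp hq hpq hadj) rfl
    rw [← hs] at this
    refine le_trans (le_of_eq ?_) (this.trans
      (mul_le_mul_of_nonneg_left (cost_eraseTwo_le h hp hq hpq.ne hw) (by norm_num)))
    congr 1
    simp only [List.map_append, List.map_cons, eval_append, eval_cons, hw, Letter.inv]
    cases (w p).2 <;> simp

end Cost

/-! ### Endomorphisms induced by maps of the pointed space -/

section Map

variable {X : Type*} (e : X)

/-- The endomorphism of `F(X, e)` that sends each generator `x` to the point `f x`. -/
noncomputable def mapHom (f : X → X) : PointedFreeGroup X e →* PointedFreeGroup X e :=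
  (FreeGroup.lift (fun x : {x : X // x ≠ e} => of e (f x)) :
    FreeGroup {x : X // x ≠ e} →* PointedFreeGroup X e)

variable {e}

theorem mapHom_of {f : X → X} (hf : f e = e) (x : X) : mapHom e f (of e x) = of e (f x) := by
  by_cases hx : x = e
  · rw [hx, hf, of_basePoint, map_one]
  · rw [of_coe ⟨x, hx⟩]
    exact FreeGroup.lift_apply_of

theorem mapHom_eval {f : X → X} (hf : f e = e) (w : List (Letter X)) :
    mapHom e f (eval e w) = eval e (w.map fun a => (f a.1, a.2)) := by
  induction w with
  | nil => exact map_one _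
  | cons a w ih =>
    rw [eval_cons, map_mul, ih, List.map_cons, eval_cons, apply_ite (mapHom e f), map_inv,
      mapHom_of hf]

theorem mapHom_eq_self {f : X → X} (hf : f e = e) {g : PointedFreeGroup X e}
    (hg : ∀ a ∈ reducedWord g, f a.1 = a.1) : mapHom e f g = g := by
  conv_lhs => rw [← eval_reducedWord g, mapHom_eval hf]
  conv_rhs => rw [← eval_reducedWord g]
  congr 1
  conv_rhs => rw [← List.map_id (reducedWord g)]
  exact List.map_congr_left fun a ha => Prod.ext (hg a ha) rfl

end Map

section Norm

variable {X : Type*} [MetricSpace X] {e : X}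

theorem Letter.dist_map_le {f : X → X} (hf : f e = e) {K : ℝ}
    (hK : ∀ x y, Dist.dist (f x) (f y) ≤ K * Dist.dist x y) (a b : Letter X) :
    Letter.dist e (f a.1, a.2) (f b.1, b.2) ≤ K * Letter.dist e a b := by
  have h₁ := hK a.1 e
  have h₂ := hK e b.1
  rw [hf] at h₁ h₂
  unfold Letter.dist
  split_ifs
  · exact hK _ _
  · rw [mul_add]
    exact add_le_add h₁ h₂

/-- A Lipschitz map of the pointed space induces an endomorphism that is Lipschitz for the Graev
norm, with the same constant. The image of a reduced word need not be reduced. -/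
theorem graevNorm_mapHom_le {f : X → X} (hf : f e = e) {K : ℝ}
    (hK : ∀ x y, dist (f x) (f y) ≤ K * dist x y) (g : PointedFreeGroup X e) :
    graevNorm (mapHom e f g) ≤ K * graevNorm g := by
  set r := reducedWord g
  obtain ⟨α, hα⟩ := exists_eq_ciInf_of_finite
    (f := fun α : {α : Equiv.Perm (Fin r.length) // IsNoncrossingInvolution α} =>
      ∑ i : Fin r.length, Letter.dist e (r.get i) (Letter.inv (r.get (α.1 i))))
  have hN : graevNorm g = 1 / 2 *
      ∑ i : Fin r.length, Letter.dist e (r.get i) (Letter.inv (r.get (α.1 i))) := by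
    rw [graevNorm, wordNorm, hα]
  have hfin : (List.finRange r.length).toFinset = Finset.univ := by ext; simp
  have hle := graevNorm_eval_le (e := e) (fun i => (f (r.get i).1, (r.get i).2))
    (List.finRange r.length) (List.sortedLT_finRange _) α.1
    (by rw [hfin]; exact (isNoncrossingInvolution_iff α.1).1 α.2)
  have hmap : (List.finRange r.length).map (fun i => (f (r.get i).1, (r.get i).2)) =
      r.map fun a => (f a.1, a.2) := by
    apply List.ext_get <;> simp
  rw [hmap, ← mapHom_eval hf, show eval e r = g from eval_reducedWord g, hfin] at hle
  rw [hN, mul_left_comm]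
  refine hle.trans (mul_le_mul_of_nonneg_left ?_ (by norm_num))
  rw [Finset.mul_sum, cost]
  refine Finset.sum_le_sum fun i _ => ?_
  exact Letter.dist_map_le hf hK (r.get i) (r.get (α.1 i)).inv

end Norm

/-! ### A group topology on the free group of the interval, and maps that collapse small sets -/

section Interval

open MeasureTheory Topology
open scoped ENNReal NNReal

/-- The normal subgroup of `F([0, 1], 0)` that identifies two points of `[0, 1]` whenever almost all
of the interval between them lies in `E`. The set `E` need not be measurable. -/
noncomputable def collapseKernel (E : Set ℝ) : Subgroup (PointedFreeGroup (Set.Icc (0 : ℝ) 1) 0) :=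
  Subgroup.normalClosure
    {u | ∃ x y : Set.Icc (0 : ℝ) 1, volume (Set.uIoc (x : ℝ) y \ E) = 0 ∧
      u = (of 0 x)⁻¹ * of 0 y}

/-- The elements of `F([0, 1], 0)` that become trivial when some set of measure less than `δ` is
collapsed. -/
def collapsible (δ : ℝ≥0∞) : Set (PointedFreeGroup (Set.Icc (0 : ℝ) 1) 0) :=
  {u | ∃ E : Set ℝ, volume E < δ ∧ u ∈ collapseKernel E}

theorem collapseKernel_mono {E E' : Set ℝ} (h : E ⊆ E') :
    collapseKernel E ≤ collapseKernel E' := by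
  refine Subgroup.normalClosure_mono ?_
  rintro u ⟨x, y, hxy, rfl⟩
  exact ⟨x, y, measure_mono_null (Set.sdiff_subset_sdiff_right h) hxy, rfl⟩

theorem collapsible_mono {δ δ' : ℝ≥0∞} (h : δ ≤ δ') : collapsible δ ⊆ collapsible δ' :=
  fun _ ⟨E, hE, hu⟩ => ⟨E, hE.trans_le h, hu⟩

/-- The sets `collapsible δ` form a basis at `1` of a group topology: the sets collapsed for two
factors can be united to collapse their product. -/
@[reducible]
noncomputable def collapsibleBasis :
    GroupFilterBasis (PointedFreeGroup (Set.Icc (0 : ℝ) 1) 0) where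
  sets := {U | ∃ δ : ℝ≥0∞, 0 < δ ∧ U = collapsible δ}
  nonempty := ⟨_, 1, one_pos, rfl⟩
  inter_sets := by
    rintro _ _ ⟨δ, hδ, rfl⟩ ⟨δ', hδ', rfl⟩
    exact ⟨_, ⟨min δ δ', lt_min hδ hδ', rfl⟩, Set.subset_inter
      (collapsible_mono (min_le_left _ _)) (collapsible_mono (min_le_right _ _))⟩
  one' := by
    rintro _ ⟨δ, hδ, rfl⟩
    exact ⟨∅, by simpa using hδ, one_mem _⟩
  mul' := by
    rintro _ ⟨δ, hδ, rfl⟩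
    refine ⟨_, ⟨δ / 2, ENNReal.half_pos hδ.ne', rfl⟩, ?_⟩
    rintro _ ⟨u, ⟨E, hE, hu⟩, v, ⟨E', hE', hv⟩, rfl⟩
    refine ⟨E ∪ E', ?_, mul_mem (collapseKernel_mono Set.subset_union_left hu)
      (collapseKernel_mono Set.subset_union_right hv)⟩
    calc volume (E ∪ E') ≤ volume E + volume E' := measure_union_le _ _
      _ < δ / 2 + δ / 2 := ENNReal.add_lt_add hE hE'
      _ = δ := ENNReal.add_halves δ
  inv' := by
    rintro _ ⟨δ, hδ, rfl⟩
    exact ⟨_, ⟨δ, hδ, rfl⟩, fun u ⟨E, hE, hu⟩ => ⟨E, hE, inv_mem hu⟩⟩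
  conj' := by
    rintro g _ ⟨δ, hδ, rfl⟩
    exact ⟨_, ⟨δ, hδ, rfl⟩, fun u ⟨E, hE, hu⟩ =>
      ⟨E, hE, Subgroup.normalClosure_normal.conj_mem u hu g⟩⟩

theorem continuous_of_collapsibleBasis :
    Continuous[inferInstance, collapsibleBasis.topology] (of (0 : Set.Icc (0 : ℝ) 1)) := by
  let _ := collapsibleBasis.topology
  rw [continuous_iff_continuousAt]
  intro x
  refine (collapsibleBasis.nhds_hasBasis _).tendsto_right_iff.2 ?_
  rintro _ ⟨δ, hδ, rfl⟩
  filter_upwards [Metric.eball_mem_nhds x hδ] with y hy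
  refine ⟨(of 0 x)⁻¹ * of 0 y, ⟨Set.uIoc (x : ℝ) y, ?_, ?_⟩, mul_inv_cancel_left _ _⟩
  · rw [Real.volume_uIoc, ← Real.dist_eq, ← edist_dist]
    exact hy
  · exact Subgroup.subset_normalClosure ⟨x, y, by simp, rfl⟩

theorem topology_le_collapsibleBasis :
    (inferInstance : TopologicalSpace (PointedFreeGroup (Set.Icc (0 : ℝ) 1) 0)) ≤
      collapsibleBasis.topology := by
  let t : GroupTopology (PointedFreeGroup (Set.Icc (0 : ℝ) 1) 0) :=
    { toTopologicalSpace := collapsibleBasis.topology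
      toIsTopologicalGroup := collapsibleBasis.isTopologicalGroup }
  have h : GroupTopology.coinduced (of (0 : Set.Icc (0 : ℝ) 1)) ≤ t :=
    sInf_le (continuous_iff_coinduced_le.1 continuous_of_collapsibleBasis)
  exact h

/-- A point of the closure of `S` in the free topological group differs from some point of `S` by
a collapsible element. -/
theorem exists_mul_mem_of_mem_closure {S : Set (PointedFreeGroup (Set.Icc (0 : ℝ) 1) 0)}
    {g : PointedFreeGroup (Set.Icc (0 : ℝ) 1) 0} (hg : g ∈ closure S) {δ : ℝ≥0∞} (hδ : 0 < δ) :
    ∃ u ∈ collapsible δ, g * u ∈ S := by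
  have hg' := closure.mono topology_le_collapsibleBasis hg
  let _ := collapsibleBasis.topology
  obtain ⟨_, hS, u, hu, rfl⟩ :=
    (mem_closure_iff_nhds_basis (collapsibleBasis.nhds_hasBasis g)).1 hg' _ ⟨δ, hδ, rfl⟩
  exact ⟨u, hu, hS⟩

/-- The set `E` can be collapsed by a map of `[0, 1]` that fixes the points of a given finite set and
is Lipschitz with constant `K > 1`, as soon as the measure of `E` is small compared with the gaps
of the finite set. -/
theorem exists_collapse (A : Finset (Set.Icc (0 : ℝ) 1)) {K : ℝ} (hK : 1 < K) :
    ∃ δ : ℝ≥0∞, 0 < δ ∧ ∀ E : Set ℝ, volume E < δ →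
      ∃ f : Set.Icc (0 : ℝ) 1 → Set.Icc (0 : ℝ) 1, (∀ a ∈ A, f a = a) ∧
        (∀ x y, dist (f x) (f y) ≤ K * dist x y) ∧
        ∀ x y : Set.Icc (0 : ℝ) 1, volume (Set.uIoc (x : ℝ) y \ E) = 0 → f x = f y := by
  obtain ⟨η, hη, hA⟩ : ∃ η : ℝ, 0 < η ∧ ∀ a ∈ A, ∀ b ∈ A, a ≠ b → η ≤ |(a : ℝ) - b| := by
    rcases A.offDiag.eq_empty_or_nonempty with h | h
    · refine ⟨1, one_pos, fun a ha b hb hab => ?_⟩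
      have : (a, b) ∈ A.offDiag := Finset.mem_offDiag.2 ⟨ha, hb, hab⟩
      rw [h] at this
      exact absurd this (Finset.notMem_empty _)
    · obtain ⟨m, hm, hmin⟩ := A.offDiag.exists_min_image (fun z => |(z.1 : ℝ) - z.2|) h
      refine ⟨|(m.1 : ℝ) - m.2|, ?_, fun a ha b hb hab =>
        hmin (a, b) (Finset.mem_offDiag.2 ⟨ha, hb, hab⟩)⟩
      exact abs_pos.2 (sub_ne_zero.2 fun hm' => (Finset.mem_offDiag.1 hm).2.2 (Subtype.ext hm'))
  have hK' : 0 < 1 - 1 / K := by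
    rw [sub_pos, div_lt_one (by linarith)]
    exact hK
  have hδ : 0 < η * (1 - 1 / K) := mul_pos hη hK'
  refine ⟨ENNReal.ofReal (η * (1 - 1 / K)), ENNReal.ofReal_pos.2 hδ, fun E hE => ?_⟩
  set μ := (volume : Measure ℝ).restrict Eᶜ
  -- The points are read on the line from which `E` has been removed.
  set p : ℝ → ℝ := fun x => μ.real (Set.Ioc 0 x) with hp
  have hfin : ∀ x y : ℝ, μ (Set.Ioc x y) ≠ ∞ := fun x y =>
    ((Measure.restrict_apply_le _ _).trans_lt measure_Ioc_lt_top).ne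
  have hsub : ∀ x y : ℝ, 0 ≤ x → x ≤ y → p y - p x = μ.real (Set.Ioc x y) := by
    intro x y hx hxy
    rw [hp, sub_eq_iff_eq_add', ← measureReal_union (Set.Ioc_disjoint_Ioc_of_le le_rfl)
      measurableSet_Ioc (hfin _ _) (hfin _ _), Set.Ioc_union_Ioc_eq_Ioc hx hxy]
  have hdist : ∀ x y : Set.Icc (0 : ℝ) 1, |p x - p y| = μ.real (Set.uIoc (x : ℝ) y) := by
    intro x y
    rcases le_total (x : ℝ) y with h | h
    · rw [abs_sub_comm, hsub x y x.2.1 h, Set.uIoc_of_le h, abs_of_nonneg measureReal_nonneg]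
    · rw [hsub y x y.2.1 h, Set.uIoc_of_ge h, abs_of_nonneg measureReal_nonneg]
  have happ : ∀ x y : ℝ, μ (Set.uIoc x y) = volume (Set.uIoc x y \ E) := fun x y =>
    Measure.restrict_apply measurableSet_uIoc
  have hlip : ∀ x y : Set.Icc (0 : ℝ) 1, |p x - p y| ≤ dist x y := by
    intro x y
    rw [hdist, measureReal_def, happ]
    refine ENNReal.toReal_le_of_le_ofReal dist_nonneg ?_
    refine (measure_mono Set.sdiff_subset).trans_eq ?_
    rw [Real.volume_uIoc, ← Real.dist_eq, dist_comm]
    rfl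
  -- The gap `|a - b|` is at least `η`, so removing less than `η (1 - 1 / K)` from it leaves at least
  -- the fraction `1 / K`.
  have hgap : ∀ a ∈ A, ∀ b ∈ A, |(a : ℝ) - b| ≤ K * |p a - p b| := by
    intro a ha b hb
    by_cases hab : a = b
    · simp [hab]
    have h₁ := hA a ha b hb hab
    have h₂ : |(a : ℝ) - b| - η * (1 - 1 / K) ≤ |p a - p b| := by
      rw [hdist, measureReal_def, happ]
      have h₃ := (tsub_le_tsub_left hE.le _).trans
        (le_measure_sdiff (μ := volume) (s₁ := Set.uIoc (a : ℝ) b) (s₂ := E))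
      rw [Real.volume_uIoc, abs_sub_comm, ← ENNReal.ofReal_sub _ hδ.le] at h₃
      refine (ENNReal.ofReal_le_iff_le_toReal ?_).1 h₃
      rw [← happ]
      exact ((Measure.restrict_apply_le _ _).trans_lt (by simp)).ne
    have h₃ : |(a : ℝ) - b| * (1 / K) ≤ |p a - p b| := by
      have := mul_le_mul_of_nonneg_right h₁ hK'.le
      linarith
    rw [mul_one_div, div_le_iff₀ (by linarith)] at h₃
    linarith
  -- The inverse of `p` on the image of `A` is Lipschitz with constant `K`, hence extends to the line.
  have hinj : Set.InjOn (fun a : Set.Icc (0 : ℝ) 1 => p a) A := by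
    intro a ha b hb hab
    have := hgap a ha b hb
    rw [show p a = p b from hab, sub_self, abs_zero, mul_zero] at this
    exact Subtype.ext (sub_eq_zero.1 (abs_nonpos_iff.1 this))
  let q : ℝ → Set.Icc (0 : ℝ) 1 := Function.invFunOn (fun a : Set.Icc (0 : ℝ) 1 => p a) A
  have hq : ∀ a ∈ A, q (p a) = a := fun a ha => hinj.leftInvOn_invFunOn ha
  have hqlip : LipschitzOnWith K.toNNReal (fun t => (q t : ℝ))
      ((fun a : Set.Icc (0 : ℝ) 1 => p a) '' A) := by
    refine LipschitzOnWith.of_dist_le_mul ?_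
    rintro _ ⟨a, ha, rfl⟩ _ ⟨b, hb, rfl⟩
    rw [hq a ha, hq b hb, Real.coe_toNNReal K (by linarith)]
    exact hgap a ha b hb
  obtain ⟨r, hr, hrq⟩ := hqlip.extend_real
  have hf : ∀ x y : Set.Icc (0 : ℝ) 1,
      dist (Set.projIcc (0 : ℝ) 1 zero_le_one (r (p x))) (Set.projIcc 0 1 zero_le_one (r (p y))) ≤
        K * |p x - p y| := by
    intro x y
    have h₁ := (LipschitzWith.projIcc (zero_le_one (α := ℝ))).dist_le_mul (r (p x)) (r (p y))
    have h₂ := hr.dist_le_mul (p x) (p y)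
    rw [Real.coe_toNNReal K (by linarith)] at h₂
    rw [NNReal.coe_one, one_mul] at h₁
    exact h₁.trans h₂
  refine ⟨fun x => Set.projIcc 0 1 zero_le_one (r (p x)), fun a ha => ?_, fun x y => ?_,
    fun x y hxy => ?_⟩
  · have : r (p a) = a := by
      rw [← hrq (Set.mem_image_of_mem _ ha)]
      exact congrArg Subtype.val (hq a ha)
    simp only [this, Set.projIcc_val]
  · exact (hf x y).trans (mul_le_mul_of_nonneg_left (hlip x y) (by linarith))
  · have h := hf x y
    rw [hdist, measureReal_def, happ, hxy, ENNReal.toReal_zero, mul_zero] at h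
    exact dist_le_zero.1 h

theorem collapseKernel_le_ker {E : Set ℝ} {f : Set.Icc (0 : ℝ) 1 → Set.Icc (0 : ℝ) 1} (hf : f 0 = 0)
    (hE : ∀ x y : Set.Icc (0 : ℝ) 1, volume (Set.uIoc (x : ℝ) y \ E) = 0 → f x = f y) :
    collapseKernel E ≤ (mapHom 0 f).ker := by
  refine Subgroup.normalClosure_le_normal ?_
  rintro _ ⟨x, y, hxy, rfl⟩
  simp [mapHom_of hf, hE x y hxy]

end Interval

/-! ### The closure of the power subgroup -/

section PowerSubgroup

variable {X : Type*} [MetricSpace X] {e : X}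

theorem mapHom_mem_powerSubgroup {f : X → X} (hf : f e = e) {K : ℝ} (hK₀ : 0 < K)
    (hK : ∀ x y, dist (f x) (f y) ≤ K * dist x y) {n : ℕ} {c : ℝ} {g : PointedFreeGroup X e}
    (hg : g ∈ powerSubgroup e n c) : mapHom e f g ∈ powerSubgroup e n (K * c) := by
  suffices powerSubgroup e n c ≤ (powerSubgroup e n (K * c)).comap (mapHom e f) from this hg
  refine (Subgroup.closure_le _).2 ?_
  rintro _ ⟨x, hx, rfl⟩
  refine Subgroup.subset_closure ⟨mapHom e f x, ?_, map_pow _ _ _⟩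
  exact (graevNorm_mapHom_le hf hK x).trans_lt (mul_lt_mul_of_pos_left hx hK₀)

end PowerSubgroup

end PointedFreeGroup

open PointedFreeGroup in
theorem mainTheorem4 (n : ℕ) (c₁ c₂ : ℝ) (h₁ : 0 < c₁) (h₂ : c₁ < c₂) :
    closure (PointedFreeGroup.powerSubgroup (0 : Set.Icc (0 : ℝ) 1) n c₁ :
        Set (PointedFreeGroup (Set.Icc (0 : ℝ) 1) 0)) ⊆
      (PointedFreeGroup.powerSubgroup (0 : Set.Icc (0 : ℝ) 1) n c₂ :
        Set (PointedFreeGroup (Set.Icc (0 : ℝ) 1) 0)) := by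
  classical
  intro g hg
  have hK : 1 < c₂ / c₁ := (one_lt_div h₁).2 h₂
  obtain ⟨δ, hδ, hcollapse⟩ :=
    exists_collapse (insert 0 ((reducedWord g).map Prod.fst).toFinset) hK
  obtain ⟨u, ⟨E, hE, hu⟩, hgu⟩ := exists_mul_mem_of_mem_closure hg hδ
  obtain ⟨f, hfA, hfK, hfE⟩ := hcollapse E hE
  have hf0 : f 0 = 0 := hfA 0 (Finset.mem_insert_self _ _)
  have hfg : mapHom 0 f g = g := mapHom_eq_self hf0 fun a ha =>
    hfA a.1 (Finset.mem_insert_of_mem (List.mem_toFinset.2 (List.mem_map_of_mem ha)))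
  have hfu : mapHom 0 f u = 1 := collapseKernel_le_ker hf0 hfE hu
  have := mapHom_mem_powerSubgroup hf0 (by linarith) hfK hgu
  rwa [map_mul, hfg, hfu, mul_one, div_mul_cancel₀ _ h₁.ne'] at this
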